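/- Let $(E,d)$ be a metric space (not necessarily separable or complete) with Borel $\sigma$-field $\mathcal E$, and let $P$ be a Markov kernel on $(E,\mathcal E)$. For $x\in E$ let $\mathbb P_x$ be the law, on $(E^{\mathbb N_0},\mathcal E^{\otimes\mathbb N_0})$, of the Markov chain with transition kernel $P$ started at $x$. For $x,y\in E$ let $\hat{\mathcal C}(\mathbb P_x,\mathbb P_y)$ be the set of generalized couplings, i.e. of probability measures $\xi$ on $E^{\mathbb N_0}\times E^{\mathbb N_0}$ (with the product $\sigma$-field) whose first and second marginals are absolutely continuous with respect to $\mathbb P_x$ and $\mathbb P_y$, respectively. Let $\rho:E\times E\to[0,\infty)$ be such that either $\rho=d$, or $E$ is Polish and $\rho$ is lower semicontinuous and positive definite (meaning $\rho(x,y)=0$ if and only if $x=y$). Suppose that there is a set $M\in\mathcal E$ such that $\mu(M)>0$ for every invariant probability measure $\mu$ of $P$, and such that for all $x,y\in M$ there exists $\alpha_{x,y}>0$ such that for every $\varepsilon>0$ there exists $\xi^{\varepsilon}_{x,y}\in\hat{\mathcal C}(\mathbb P_x,\mathbb P_y)$ with $$\xi^{\varepsilon}_{x,y}\Big(\Big\{(u,v)\in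 E^{\mathbb N_0}\times E^{\mathbb N_0}:\ \limsup_{n\to\infty}\frac1n\sum_{i=0}^{n-1}\mathbf 1_{[0,\varepsilon]}\big(\rho(u_i,v_i)\big)\ \ge\ \alpha_{x,y}\Big\}\Big)>0,$$ where, if the event is not measurable, its probability is understood as its outer measure under $\xi^{\varepsilon}_{x,y}$. Then $P$ has at most one invariant probability measure. -/

import Mathlib

open MeasureTheory ProbabilityTheory Filter

noncomputable section

/-- The transition from the history `(x₀, …, xₙ)` of a time-homogeneous Markov chain to its next
state: it only depends on the present state `xₙ`, through the kernel `P`. -/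
def chainStep {E : Type*} [MeasurableSpace E] (P : Kernel E E) (n : ℕ) :
    Kernel ((_i : Finset.Iic n) → E) E :=
  P.comap (fun h => h ⟨n, Finset.mem_Iic.2 le_rfl⟩) (measurable_pi_apply _)

instance chainStep.instIsMarkovKernel {E : Type*} [MeasurableSpace E] (P : Kernel E E)
    [IsMarkovKernel P] (n : ℕ) : IsMarkovKernel (chainStep P n) := by
  unfold chainStep
  infer_instance

/-- The law on the path space `E^ℕ` (with the product σ-algebra) of the Markov chain with
transition kernel `P` started at `x`. -/
def chainLaw {E : Type*} [MeasurableSpace E] (P : Kernel E E) [IsMarkovKernel P] (x : E) :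
    Measure (ℕ → E) :=
  Kernel.traj (X := fun _ => E) (chainStep P) 0 (fun _ => x)

/-- Generalized couplings of `μ` and `ν`: probability measures on the product whose marginals are
absolutely continuous with respect to `μ` and `ν`. -/
def generalizedCouplings {Ω : Type*} [MeasurableSpace Ω] (μ ν : Measure Ω) :
    Set (Measure (Ω × Ω)) :=
  {ξ | IsProbabilityMeasure ξ ∧ ξ.map Prod.fst ≪ μ ∧ ξ.map Prod.snd ≪ ν}

/-- `(1/n) ∑_{i<n} 1_{[0,ε]}(ρ(uᵢ, vᵢ))`. -/
def closenessFrequency {E : Type*} (ρ : E → E → ℝ) (ε : ℝ) (u v : ℕ → E) (n : ℕ) : ℝ :=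
  (1 / (n : ℝ)) * ∑ i ∈ Finset.range n, (Set.Icc 0 ε).indicator (fun _ => (1 : ℝ)) (ρ (u i) (v i))

end

/-! Two distinct invariant probability measures yield two mutually singular ones `μ`, `ν`: the
normalised Jordan parts of their difference (`exists_mutuallySingular_invariant`). Up to mass `4⁻ᵏ`,
these live on sets `F k`, `G k` with `ρ > ε k` on `F k ×ˢ G k`. The maximal ergodic inequality for
the stationary chain and Borel–Cantelli show that, for large `k`, the complement of `F k` is visited
with upper frequency at most `2⁻ᵏ`. This frequency is shift invariant, hence almost surely constant
under the chain from `μ`-almost every `x` (`ae_ae_eq_integral_chainLaw`), so for large `k` the bound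
holds almost surely from such an `x` (`ae_eventually_ae_upperFrequency_le`). The same applies to `ν`
and `G k`. Almost sure statements pass to generalized couplings. For good `x, y ∈ M`, coupled paths
are therefore `ε k`-close with upper frequency at most `2 · 2⁻ᵏ`, which is below `α` for large `k`:
a contradiction. Neither the ergodic decomposition nor Birkhoff's pointwise theorem is used. -/

/-! ### Path laws, the Markov property and stationarity. -/

-- By induction, the initial law and the one-step kernels determine the laws of all initial
-- segments, hence all finite-dimensional marginals, hence the measure as a projective limit.
open Preorder in
theorem pathMeasure_ext {E : Type*} [MeasurableSpace E]
    (κ : (n : ℕ) → Kernel ((_i : Finset.Iic n) → E) E)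
    {Q Q' : Measure (ℕ → E)} [IsFiniteMeasure Q] [IsFiniteMeasure Q']
    (h0 : Q.map (fun u => u 0) = Q'.map (fun u => u 0))
    (hQ : ∀ b, Q.map (fun u => (frestrictLe (π := fun _ => E) b u, u (b + 1))) =
      Q.map (frestrictLe (π := fun _ => E) b) ⊗ₘ κ b)
    (hQ' : ∀ b, Q'.map (fun u => (frestrictLe (π := fun _ => E) b u, u (b + 1))) =
      Q'.map (frestrictLe (π := fun _ => E) b) ⊗ₘ κ b) : Q = Q' := by
  have key : ∀ b, Q.map (frestrictLe (π := fun _ => E) b) =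
      Q'.map (frestrictLe (π := fun _ => E) b) := by
    intro b
    induction b with
    | zero =>
      have hm : Measurable (fun (e : E) (_ : Finset.Iic 0) => e) :=
        measurable_pi_lambda _ fun _ => measurable_id
      have e : frestrictLe (π := fun _ => E) 0 =
          (fun (e : E) (_ : Finset.Iic 0) => e) ∘ fun u : ℕ → E => u 0 := by
        funext u i
        have : (i : ℕ) = 0 := Nat.le_zero.1 (Finset.mem_Iic.1 i.2)
        simp [this]
      rw [e, ← Measure.map_map hm (measurable_pi_apply 0),
        ← Measure.map_map hm (measurable_pi_apply 0), h0]
    | succ b ih =>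
      let g : ((_i : Finset.Iic b) → E) × E → ((_i : Finset.Iic (b + 1)) → E) :=
        fun p i => if h : i.1 ≤ b then p.1 ⟨i.1, Finset.mem_Iic.2 h⟩ else p.2
      have hg : Measurable g := by
        refine measurable_pi_lambda _ fun i => ?_
        by_cases h : i.1 ≤ b
        · simp only [g, h, dite_true]; fun_prop
        · simp only [g, h, dite_false]; fun_prop
      have e : frestrictLe (π := fun _ => E) (b + 1) =
          g ∘ fun u : ℕ → E => (frestrictLe (π := fun _ => E) b u, u (b + 1)) := by
        funext u i
        by_cases h : i.1 ≤ b
        · simp [g, h]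
        · have hi := Finset.mem_Iic.1 i.2
          have : (i : ℕ) = b + 1 := by omega
          simp [g, this]
      have hp : Measurable fun u : ℕ → E => (frestrictLe (π := fun _ => E) b u, u (b + 1)) := by
        fun_prop
      rw [e, ← Measure.map_map hg hp, ← Measure.map_map hg hp, hQ, hQ', ih]
  refine IsProjectiveLimit.unique (P := fun I => Q.map I.restrict) (fun I => rfl) fun I => ?_
  have hI := I.subset_Iic_sup_id
  have e : I.restrict (π := fun _ : ℕ => E) =
      Finset.restrict₂ (π := fun _ => E) hI ∘ frestrictLe (π := fun _ => E) (I.sup id) := rfl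
  simp only [e]
  have hm : Measurable (Finset.restrict₂ (π := fun _ : ℕ => E) hI) :=
    Finset.measurable_restrict₂ _
  rw [← Measure.map_map hm (by fun_prop), ← Measure.map_map hm (by fun_prop), key]

theorem compProd_comap_map {X Y Z : Type*} [MeasurableSpace X] [MeasurableSpace Y]
    [MeasurableSpace Z] (μ : Measure X) [SFinite μ] (κ : Kernel Y Z) [IsSFiniteKernel κ]
    {f : X → Y} (hf : Measurable f) :
    (μ ⊗ₘ κ.comap f hf).map (Prod.map f id) = μ.map f ⊗ₘ κ := by
  ext s hs
  rw [Measure.map_apply (by fun_prop) hs, Measure.compProd_apply (hs.preimage (by fun_prop)),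
    Measure.compProd_apply hs, lintegral_map (Kernel.measurable_kernel_prodMk_left hs) hf]
  rfl

open Preorder in
/-- **Markov property**: given the history up to time `n`, the chain after time `n` is distributed
as the chain started at the present state. -/
theorem traj_chainStep_map_shift {E : Type*} [MeasurableSpace E] (P : Kernel E E)
    [IsMarkovKernel P] (n : ℕ) (h : (_i : Finset.Iic n) → E) :
    (Kernel.traj (X := fun _ => E) (chainStep P) n h).map (fun u i => u (n + i)) =
      chainLaw P (h ⟨n, Finset.mem_Iic.2 le_rfl⟩) := by
  have step : ∀ (n : ℕ) (h : (_i : Finset.Iic n) → E) (b : ℕ),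
      ((Kernel.traj (X := fun _ => E) (chainStep P) n h).map (fun u i => u (n + i))).map
        (fun u => (frestrictLe (π := fun _ => E) b u, u (b + 1))) =
      ((Kernel.traj (X := fun _ => E) (chainStep P) n h).map (fun u i => u (n + i))).map
        (frestrictLe (π := fun _ => E) b) ⊗ₘ chainStep P b := by
    intro n h b
    let w : ((_i : Finset.Iic (n + b)) → E) → ((_i : Finset.Iic b) → E) := fun x i =>
      x ⟨n + i.1, Finset.mem_Iic.2 (Nat.add_le_add_left (Finset.mem_Iic.1 i.2) n)⟩
    have hw : Measurable w := by fun_prop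
    -- Time homogeneity: both kernels read only the last coordinate, which the window `w` preserves.
    have e1 : (chainStep P b).comap w hw = chainStep P (n + b) := by
      ext x s hs
      rfl
    have hs : Measurable (fun (u : ℕ → E) i => u (n + i)) := by fun_prop
    have e2 := Kernel.partialTraj_compProd_eq_map_traj (X := fun _ => E) (κ := chainStep P)
      (Nat.le_add_right n b) (x₀ := h)
    rw [Measure.map_map (by fun_prop) hs, Measure.map_map (by fun_prop) hs]
    have e3 : (Kernel.traj (X := fun _ => E) (chainStep P) n h).map
        (frestrictLe (π := fun _ => E) b ∘ fun u i => u (n + i)) =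
        (Kernel.partialTraj (X := fun _ => E) (chainStep P) n (n + b) h).map w := by
      rw [← Kernel.traj_map_frestrictLe_apply, Measure.map_map hw (by fun_prop)]
      rfl
    rw [e3, ← compProd_comap_map _ _ hw, e1, e2, Measure.map_map (by fun_prop) (by fun_prop)]
    rfl
  have start : ∀ (n : ℕ) (h : (_i : Finset.Iic n) → E),
      ((Kernel.traj (X := fun _ => E) (chainStep P) n h).map (fun u i => u (n + i))).map
        (fun u => u 0) = Measure.dirac (h ⟨n, Finset.mem_Iic.2 le_rfl⟩) := by
    intro n h
    have e := Kernel.traj_map_frestrictLe_apply (X := fun _ => E) (κ := chainStep P) n n h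
    rw [Kernel.partialTraj_self, Kernel.id_apply] at e
    have := congrArg (Measure.map fun x => x ⟨n, Finset.mem_Iic.2 le_rfl⟩) e
    rw [Measure.map_map (by fun_prop) (by fun_prop), Measure.map_dirac' (by fun_prop)] at this
    rw [Measure.map_map (by fun_prop) (by fun_prop), ← this]
    rfl
  have e0 : chainLaw P (h ⟨n, Finset.mem_Iic.2 le_rfl⟩) = (Kernel.traj (X := fun _ => E)
      (chainStep P) 0 fun _ => h ⟨n, Finset.mem_Iic.2 le_rfl⟩).map (fun u i => u (0 + i)) := by
    simp only [zero_add]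
    exact Measure.map_id.symm
  rw [e0]
  have := Measure.isProbabilityMeasure_map
    (μ := Kernel.traj (X := fun _ => E) (chainStep P) n h) (f := fun u i => u (n + i))
    (Measurable.aemeasurable (by fun_prop))
  have := Measure.isProbabilityMeasure_map (μ := Kernel.traj (X := fun _ => E) (chainStep P) 0
    fun _ => h ⟨n, Finset.mem_Iic.2 le_rfl⟩) (f := fun u i => u (0 + i))
    (Measurable.aemeasurable (by fun_prop))
  refine pathMeasure_ext (chainStep P) ?_ (step n h) (step 0 _)
  rw [start, start]

/-- `chainLaw` as a kernel. -/
noncomputable def chainKernel {E : Type*} [MeasurableSpace E] (P : Kernel E E)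
    [IsMarkovKernel P] : Kernel E (ℕ → E) :=
  (Kernel.traj (X := fun _ => E) (chainStep P) 0).comap (fun x _ => x)
    (measurable_pi_lambda _ fun _ => measurable_id)

instance {E : Type*} [MeasurableSpace E] (P : Kernel E E) [IsMarkovKernel P] :
    IsMarkovKernel (chainKernel P) := by
  unfold chainKernel
  infer_instance

theorem chainKernel_apply {E : Type*} [MeasurableSpace E] (P : Kernel E E)
    [IsMarkovKernel P] (x : E) : chainKernel P x = chainLaw P x := rfl

instance {E : Type*} [MeasurableSpace E] (P : Kernel E E) [IsMarkovKernel P] (x : E) :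
    IsProbabilityMeasure (chainLaw P x) := by
  rw [← chainKernel_apply]
  infer_instance

-- Split the trajectory at time 1 and apply the Markov property there.
open Preorder in
theorem chainKernel_map_shift {E : Type*} [MeasurableSpace E] (P : Kernel E E)
    [IsMarkovKernel P] :
    (chainKernel P).map (fun u i => u (i + 1)) = chainKernel P ∘ₖ P := by
  ext x s hs
  have hm : Measurable (fun (u : ℕ → E) i => u (i + 1)) := by fun_prop
  have h1 := Kernel.traj_comp_partialTraj (X := fun _ => E) (κ := chainStep P) (Nat.zero_le 1)
  have h2 := Kernel.map_partialTraj_succ_self (X := fun _ => E) (κ := chainStep P) 0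
  have h3 : P x = (Kernel.partialTraj (X := fun _ => E) (chainStep P) 0 1 fun _ => x).map
      (fun y => y ⟨1, Finset.mem_Iic.2 le_rfl⟩) := by
    rw [← Kernel.map_apply _ (by fun_prop)]
    exact (congrArg (fun k => k fun _ => x) h2).symm
  rw [Kernel.map_apply' _ hm _ hs, Kernel.comp_apply' _ _ _ hs, h3,
    lintegral_map (Kernel.measurable_coe _ hs) (by fun_prop), chainKernel_apply, chainLaw, ← h1,
    Kernel.comp_apply' _ _ _ (hm hs)]
  refine lintegral_congr fun h => ?_
  rw [chainKernel_apply, ← traj_chainStep_map_shift P 1 h,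
    Measure.map_apply (by fun_prop) hs]
  simp only [add_comm 1]

theorem measurePreserving_shift {E : Type*} [MeasurableSpace E] (P : Kernel E E)
    [IsMarkovKernel P] {μ : Measure E} (hμ : P.Invariant μ) :
    MeasurePreserving (fun (u : ℕ → E) i => u (i + 1)) (μ.bind (chainKernel P))
      (μ.bind (chainKernel P)) := by
  have hm : Measurable (fun (u : ℕ → E) i => u (i + 1)) := by fun_prop
  refine ⟨hm, ?_⟩
  rw [Measure.map_comp _ _ hm, chainKernel_map_shift, ← Measure.comp_assoc, hμ.def]

theorem chainLaw_map_zero {E : Type*} [MeasurableSpace E] (P : Kernel E E)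
    [IsMarkovKernel P] (x : E) : (chainLaw P x).map (fun u => u 0) = Measure.dirac x := by
  have e := Kernel.traj_map_frestrictLe_apply (X := fun _ => E) (κ := chainStep P) 0 0 fun _ => x
  rw [Kernel.partialTraj_self, Kernel.id_apply] at e
  have := congrArg (Measure.map fun x => x ⟨0, Finset.mem_Iic.2 le_rfl⟩) e
  rw [Measure.map_map (by fun_prop) (by fun_prop), Measure.map_dirac' (by fun_prop)] at this
  exact this

/-! ### Shift invariant functions of the chain. -/

theorem iSup_piLE_nat {E : Type*} [MeasurableSpace E] :
    ⨆ n, Filtration.piLE (X := fun _ : ℕ => E) n = MeasurableSpace.pi := by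
  refine le_antisymm (iSup_le fun n => Filtration.le _ n) (iSup_le fun n => ?_)
  refine le_trans ?_ (le_iSup _ n)
  rw [Filtration.piLE_eq_comap_frestrictLe, ← measurable_iff_comap_le]
  have : (fun u : ℕ → E => u n) =
      (fun h : (_i : Finset.Iic n) → E => h ⟨n, Finset.mem_Iic.2 le_rfl⟩) ∘
        Preorder.frestrictLe n := rfl
  exact (measurable_pi_apply (⟨n, Finset.mem_Iic.2 le_rfl⟩ : Finset.Iic n)).comp
    (comap_measurable (Preorder.frestrictLe (π := fun _ => E) n))

/-- By Lévy's upward theorem, the conditional expectations of a bounded shift invariant function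
converge to it along the chain. -/
theorem tendsto_integral_chainLaw {E : Type*} [MeasurableSpace E] (P : Kernel E E)
    [IsMarkovKernel P] {f : (ℕ → E) → ℝ} (hf : Measurable f) {C : ℝ} (hC : ∀ u, |f u| ≤ C)
    (hinv : ∀ n u, f (fun i => u (n + i)) = f u) (x : E) :
    ∀ᵐ u ∂chainLaw P x, Tendsto (fun n => ∫ v, f v ∂chainLaw P (u n)) atTop (nhds (f u)) := by
  have hint : Integrable f (chainLaw P x) :=
    .of_bound hf.aestronglyMeasurable C (ae_of_all _ hC)
  have h1 := hint.tendsto_ae_condExp (ℱ := Filtration.piLE (X := fun _ : ℕ => E))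
    (by rw [iSup_piLE_nat]; exact hf.stronglyMeasurable)
  -- Invariance replaces `f` by its shift by `n`, which by the Markov property sees a fresh chain
  -- started at `u n`.
  have h2 : ∀ n, (chainLaw P x)[f | Filtration.piLE (X := fun _ : ℕ => E) n] =ᵐ[chainLaw P x]
      fun u => ∫ v, f v ∂chainLaw P (u n) := by
    intro n
    refine (Kernel.condExp_traj (X := fun _ => E) (κ := chainStep P) (Nat.zero_le n)
      hint).trans (ae_of_all _ fun u => ?_)
    have := traj_chainStep_map_shift P n (Preorder.frestrictLe n u)
    simp only [Preorder.frestrictLe_apply] at this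
    simp only
    rw [← this, integral_map (Measurable.aemeasurable (by fun_prop)) hf.aestronglyMeasurable]
    simp only [hinv]
  filter_upwards [h1, ae_all_iff.2 h2] with u hu1 hu2
  exact hu1.congr hu2

/-- A bounded shift invariant function of a stationary chain is a function of the initial state. -/
theorem ae_ae_eq_integral_chainLaw {E : Type*} [MeasurableSpace E] (P : Kernel E E)
    [IsMarkovKernel P] {μ : Measure E} [IsFiniteMeasure μ] (hμ : P.Invariant μ)
    {f : (ℕ → E) → ℝ} (hf : Measurable f) {C : ℝ} (hC : ∀ u, |f u| ≤ C)
    (hinv : ∀ u, f (fun i => u (i + 1)) = f u) :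
    ∀ᵐ x ∂μ, ∀ᵐ u ∂chainLaw P x, f u = ∫ v, f v ∂chainLaw P x := by
  have hinv' : ∀ n u, f (fun i => u (n + i)) = f u := by
    intro n
    induction n with
    | zero => simp
    | succ n ih =>
      intro u
      rw [← hinv u, ← ih (fun i => u (i + 1))]
      congr 1
      funext i
      congr 1
      omega
  set h : E → ℝ := fun x => ∫ v, f v ∂chainLaw P x with hh
  have hhm : Measurable h :=
    (hf.stronglyMeasurable.integral_kernel (κ := chainKernel P)).measurable
  have hhC : ∀ x, |h x| ≤ C := fun x => by
    have := norm_integral_le_of_norm_le_const (μ := chainLaw P x) (f := f) (ae_of_all _ hC)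
    simpa using this
  set m := μ.bind (chainKernel P) with hm
  have hT : MeasurePreserving (fun (u : ℕ → E) i => u (i + 1)) m m :=
    measurePreserving_shift P hμ
  -- By stationarity this L¹ distance does not depend on `n`; since it tends to `0`, it already
  -- vanishes at `n = 0`.
  have hconst : ∀ n, ∫ u, |f u - h (u n)| ∂m = ∫ u, |f u - h (u 0)| ∂m := by
    intro n
    induction n with
    | zero => rfl
    | succ n ih =>
      rw [← ih]
      have hg : Measurable fun u : ℕ → E => |f u - h (u n)| := by fun_prop
      conv_rhs => rw [← hT.map_eq]
      rw [integral_map hT.measurable.aemeasurable hg.aestronglyMeasurable]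
      simp only [hinv]
  have hlim : ∀ᵐ u ∂m, Tendsto (fun n => |f u - h (u n)|) atTop (nhds 0) := by
    have hmeas : MeasurableSet {u : ℕ → E | Tendsto (fun n => |f u - h (u n)|) atTop (nhds 0)} :=
      measurableSet_tendsto _ fun n => by fun_prop
    rw [hm]
    refine (Measure.ae_comp_iff hmeas).2 (ae_of_all _ fun x => ?_)
    filter_upwards [tendsto_integral_chainLaw P hf hC hinv' x] with u hu
    have := (tendsto_const_nhds (x := f u)).sub hu
    simpa using this.abs
  have hzero : ∫ u, |f u - h (u 0)| ∂m = 0 := by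
    have := tendsto_integral_of_dominated_convergence (μ := m)
      (F := fun n (u : ℕ → E) => |f u - h (u n)|) (f := fun _ => 0) (fun _ => C + C)
      (fun n => Measurable.aestronglyMeasurable (by fun_prop)) (integrable_const _)
      (fun n => ae_of_all _ fun u => by
        simp only [Real.norm_eq_abs, abs_abs]
        exact (abs_sub _ _).trans (add_le_add (hC u) (hhC _))) hlim
    simp only [hconst, integral_zero] at this
    exact tendsto_nhds_unique tendsto_const_nhds this
  rw [integral_eq_zero_iff_of_nonneg (fun _ => abs_nonneg _)
    (.of_bound (Measurable.aestronglyMeasurable (by fun_prop)) (C + C) (ae_of_all _ fun u => by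
        simp only [Real.norm_eq_abs, abs_abs]
        exact (abs_sub _ _).trans (add_le_add (hC u) (hhC _))))] at hzero
  have h5 : ∀ᵐ x ∂μ, ∀ᵐ u ∂chainKernel P x, f u = h (u 0) := by
    refine Measure.ae_ae_of_ae_comp ?_
    filter_upwards [hzero] with u hu
    simpa [sub_eq_zero] using hu
  filter_upwards [h5] with x hx
  rw [chainKernel_apply] at hx
  -- Singletons of `E` need not be measurable here, so the Dirac mass is tested on a level set of
  -- `h`.
  have h6 : ∀ᵐ y ∂(chainLaw P x).map (fun u => u 0), h y = h x := by
    rw [chainLaw_map_zero]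
    exact (ae_dirac_iff (hhm (measurableSet_singleton (h x)))).2 rfl
  filter_upwards [hx, ae_of_ae_map (measurable_pi_apply 0).aemeasurable h6] with u hu1 hu2
  rw [hu1, hu2]

/-! ### The maximal ergodic inequality. -/

/-- The maximum of `0` and of the first `n` Birkhoff sums of `f`. -/
noncomputable def maxBirkhoffSum {X : Type*} (T : X → X) (f : X → ℝ) : ℕ → X → ℝ
  | 0 => 0
  | n + 1 => fun x => max 0 (f x + maxBirkhoffSum T f n (T x))

theorem maxBirkhoffSum_nonneg {X : Type*} (T : X → X) (f : X → ℝ) (n : ℕ) (x : X) :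
    0 ≤ maxBirkhoffSum T f n x := by
  cases n with
  | zero => exact le_rfl
  | succ n => exact le_max_left _ _

theorem maxBirkhoffSum_monotone {X : Type*} (T : X → X) (f : X → ℝ) (x : X) :
    Monotone fun n => maxBirkhoffSum T f n x := by
  refine monotone_nat_of_le_succ fun n => ?_
  induction n generalizing x with
  | zero => exact maxBirkhoffSum_nonneg T f 1 x
  | succ n ih => exact max_le_max le_rfl (by simpa using ih (T x))

theorem birkhoffSum_le_maxBirkhoffSum {X : Type*} (T : X → X) (f : X → ℝ) (n : ℕ) (x : X) :
    birkhoffSum T f n x ≤ maxBirkhoffSum T f n x := by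
  induction n generalizing x with
  | zero => simp [maxBirkhoffSum]
  | succ n ih =>
    rw [birkhoffSum_succ']
    exact (add_le_add le_rfl (ih (T x))).trans (le_max_right _ _)

theorem measurable_maxBirkhoffSum {X : Type*} [MeasurableSpace X] {T : X → X} (hT : Measurable T)
    {f : X → ℝ} (hf : Measurable f) (n : ℕ) : Measurable (maxBirkhoffSum T f n) := by
  induction n with
  | zero => exact measurable_const
  | succ n ih => exact measurable_const.max (hf.add (ih.comp hT))

theorem integrable_maxBirkhoffSum {X : Type*} [MeasurableSpace X] {m : Measure X} {T : X → X}
    (hT : MeasurePreserving T m m) {f : X → ℝ} (hf : Integrable f m) (n : ℕ) :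
    Integrable (maxBirkhoffSum T f n) m := by
  induction n with
  | zero => exact integrable_zero _ _ _
  | succ n ih =>
    exact (integrable_zero X ℝ m).sup (hf.add (hT.integrable_comp_of_integrable ih))

/-- **Maximal ergodic theorem.** -/
theorem setIntegral_maxBirkhoffSum_pos_nonneg {X : Type*} [MeasurableSpace X] {m : Measure X}
    {T : X → X} (hT : MeasurePreserving T m m) {f : X → ℝ} (hfm : Measurable f)
    (hf : Integrable f m) (n : ℕ) : 0 ≤ ∫ x in {x | 0 < maxBirkhoffSum T f n x}, f x ∂m := by
  cases n with
  | zero => simp [maxBirkhoffSum]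
  | succ n =>
    set F := maxBirkhoffSum T f (n + 1) with hF
    have hFm : Measurable F := measurable_maxBirkhoffSum hT.measurable hfm _
    have hFi : Integrable F m := integrable_maxBirkhoffSum hT hf _
    have hFT : Integrable (fun x => F (T x)) m := hT.integrable_comp_of_integrable hFi
    have hA : MeasurableSet {x | 0 < F x} := measurableSet_lt measurable_const hFm
    have h1 : ∫ x in {x | 0 < F x}, F x ∂m = ∫ x, F x ∂m := by
      refine setIntegral_eq_integral_of_forall_compl_eq_zero fun x hx => ?_
      exact le_antisymm (not_lt.1 hx) (maxBirkhoffSum_nonneg T f _ x)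
    have h2 : ∫ x in {x | 0 < F x}, F (T x) ∂m ≤ ∫ x, F (T x) ∂m :=
      setIntegral_le_integral hFT (ae_of_all _ fun x => maxBirkhoffSum_nonneg T f _ _)
    have h3 : ∫ x, F (T x) ∂m = ∫ x, F x ∂m := by
      conv_rhs => rw [← hT.map_eq]
      rw [integral_map hT.measurable.aemeasurable hFm.aestronglyMeasurable]
    -- Garsia's argument: on `{F > 0}` the recursion gives `F ≤ f + F ∘ T`, while `h1`, `h2`, `h3`
    -- make the integral of `F - F ∘ T` over this set nonnegative.
    have h4 : ∫ x in {x | 0 < F x}, (F x - F (T x)) ∂m ≤ ∫ x in {x | 0 < F x}, f x ∂m := by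
      refine setIntegral_mono_on (hFi.sub hFT).integrableOn hf.integrableOn hA fun x hx => ?_
      have hx' : F x = f x + maxBirkhoffSum T f n (T x) := by
        refine max_eq_right_of_lt ?_
        by_contra hneg
        exact (ne_of_gt hx) (max_eq_left (not_lt.1 hneg))
      have : maxBirkhoffSum T f n (T x) ≤ F (T x) :=
        maxBirkhoffSum_monotone T f (T x) (Nat.le_succ n)
      linarith
    rw [integral_sub hFi.integrableOn hFT.integrableOn] at h4
    linarith

/-- **Maximal inequality** for the frequency of visits to a set. -/
theorem measure_birkhoffSum_indicator_gt_le {X : Type*} [MeasurableSpace X] {m : Measure X}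
    [IsFiniteMeasure m] {T : X → X} (hT : MeasurePreserving T m m) {B : Set X}
    (hB : MeasurableSet B) {c : ℝ} (hc : 0 < c) :
    ENNReal.ofReal c *
      m {x | ∃ n : ℕ, n * c < birkhoffSum T (B.indicator fun _ => (1 : ℝ)) n x} ≤ m B := by
  set g : X → ℝ := B.indicator fun _ => (1 : ℝ) with hg
  have hgm : Measurable g := measurable_const.indicator hB
  have hgi : Integrable g m := (integrable_const _).indicator hB
  -- Subtracting `c` turns an average of `g` above `c` into a positive Birkhoff sum.
  set f : X → ℝ := fun x => g x - c with hf
  have hfm : Measurable f := hgm.sub_const c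
  have hfi : Integrable f m := hgi.sub (integrable_const c)
  have hsum : ∀ n x, birkhoffSum T f n x = birkhoffSum T g n x - n * c := by
    intro n x
    simp [birkhoffSum, hf, Finset.sum_sub_distrib]
  set A : ℕ → Set X := fun n => {x | 0 < maxBirkhoffSum T f n x} with hA
  have hAm : ∀ n, MeasurableSet (A n) := fun n =>
    measurableSet_lt measurable_const (measurable_maxBirkhoffSum hT.measurable hfm n)
  have hAmono : Monotone A := fun i j hij x hx =>
    lt_of_lt_of_le hx (maxBirkhoffSum_monotone T f x hij)
  have hsub : {x | ∃ n : ℕ, n * c < birkhoffSum T g n x} ⊆ ⋃ n, A n := by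
    rintro x ⟨n, hn⟩
    refine Set.mem_iUnion.2 ⟨n, lt_of_lt_of_le ?_ (birkhoffSum_le_maxBirkhoffSum T f n x)⟩
    rw [hsum]
    linarith
  have hbound : ∀ n, ENNReal.ofReal c * m (A n) ≤ m B := by
    intro n
    have h1 := setIntegral_maxBirkhoffSum_pos_nonneg hT hfm hfi n
    rw [integral_sub hgi.integrableOn (integrable_const c), setIntegral_const] at h1
    have h2 : ∫ x in A n, g x ∂m ≤ m.real B := by
      refine (setIntegral_le_integral hgi (ae_of_all _ fun x => ?_)).trans_eq ?_
      · exact Set.indicator_nonneg (fun _ _ => zero_le_one) x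
      · rw [hg, integral_indicator hB]; simp
    have h3 : c * m.real (A n) ≤ m.real B := by
      rw [smul_eq_mul] at h1
      linarith
    rw [← ENNReal.ofReal_toReal (measure_ne_top m (A n)), ← ENNReal.ofReal_mul hc.le]
    exact (ENNReal.ofReal_le_ofReal h3).trans_eq (ENNReal.ofReal_toReal (measure_ne_top m B))
  calc ENNReal.ofReal c * m {x | ∃ n : ℕ, n * c < birkhoffSum T g n x}
      ≤ ENNReal.ofReal c * m (⋃ n, A n) := by gcongr
    _ = ⨆ n, ENNReal.ofReal c * m (A n) := by
      rw [hAmono.measure_iUnion, ENNReal.mul_iSup]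
    _ ≤ m B := iSup_le hbound

/-! ### Upper frequencies of visits. -/

/-- The upper frequency of the visits of the sequence `u` to the set `B`. -/
noncomputable def upperFrequency {E : Type*} (B : Set E) (u : ℕ → E) : ℝ :=
  limsup (fun n : ℕ => (1 / (n : ℝ)) * ∑ i ∈ Finset.range n, B.indicator (fun _ => (1 : ℝ)) (u i))
    atTop

/-- Valid for `n = 0` too, where `1 / 0 = 0`. These bounds keep the real-valued `limsup` meaningful.
-/
theorem frequency_mem_Icc {E : Type*} (B : Set E) (u : ℕ → E) (n : ℕ) :
    (1 / (n : ℝ)) * ∑ i ∈ Finset.range n, B.indicator (fun _ => (1 : ℝ)) (u i) ∈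
      Set.Icc (0 : ℝ) 1 := by
  have h0 : ∀ i, 0 ≤ B.indicator (fun _ => (1 : ℝ)) (u i) := fun i =>
    Set.indicator_nonneg (fun _ _ => zero_le_one) _
  have h1 : ∑ i ∈ Finset.range n, B.indicator (fun _ => (1 : ℝ)) (u i) ≤ n := by
    refine (Finset.sum_le_sum fun i _ => Set.indicator_le_self' (fun _ _ => zero_le_one)
      (u i)).trans ?_
    simp
  refine ⟨mul_nonneg (by positivity) (Finset.sum_nonneg fun i _ => h0 i), ?_⟩
  rw [one_div_mul_eq_div]
  exact div_le_one_of_le₀ h1 (by positivity)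

theorem isBoundedUnder_of_mem_Icc {a : ℕ → ℝ} {c d : ℝ} (h : ∀ n, a n ∈ Set.Icc c d) :
    IsBoundedUnder (· ≤ ·) atTop a ∧ IsBoundedUnder (· ≥ ·) atTop a :=
  ⟨isBoundedUnder_of ⟨d, fun n => (h n).2⟩, isBoundedUnder_of ⟨c, fun n => (h n).1⟩⟩

theorem upperFrequency_mem_Icc {E : Type*} (B : Set E) (u : ℕ → E) :
    upperFrequency B u ∈ Set.Icc (0 : ℝ) 1 := by
  obtain ⟨h1, h2⟩ := isBoundedUnder_of_mem_Icc (frequency_mem_Icc B u)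
  exact ⟨le_limsup_of_le h1 fun b hb =>
      let ⟨n, hn⟩ := hb.exists
      (frequency_mem_Icc B u n).1.trans hn,
    limsup_le_of_le h2.isCoboundedUnder_le
      (Eventually.of_forall fun n => (frequency_mem_Icc B u n).2)⟩

theorem measurable_upperFrequency {E : Type*} [MeasurableSpace E] {B : Set E}
    (hB : MeasurableSet B) : Measurable (upperFrequency B) := by
  refine Measurable.limsup fun n => measurable_const.mul (Finset.measurable_sum _ fun i _ => ?_)
  exact (measurable_const.indicator hB).comp (measurable_pi_apply i)

theorem limsup_le_limsup_of_tendsto_sub {a b : ℕ → ℝ} {c d : ℝ}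
    (hb : ∀ n, b n ∈ Set.Icc c d) (hab : Tendsto (fun n => a n - b n) atTop (nhds 0)) :
    limsup a atTop ≤ limsup b atTop := by
  have h := limsup_add_le (f := atTop) (u := b) (v := fun n => a n - b n)
    (isBoundedUnder_of_mem_Icc hb).2 (isBoundedUnder_of_mem_Icc hb).1
    hab.isBoundedUnder_ge.isCoboundedUnder_le hab.isBoundedUnder_le
  rw [hab.limsup_eq, add_zero] at h
  refine le_trans (le_of_eq ?_) h
  congr 1
  funext n
  simp

/-- The difference of the two averages telescopes and is at most `1 / n`. -/
theorem upperFrequency_shift {E : Type*} (B : Set E) (u : ℕ → E) :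
    upperFrequency B (fun i => u (i + 1)) = upperFrequency B u := by
  set g : ℕ → ℝ := fun i => B.indicator (fun _ => (1 : ℝ)) (u i) with hg
  have hg01 : ∀ i, g i ∈ Set.Icc (0 : ℝ) 1 := fun i =>
    ⟨Set.indicator_nonneg (fun _ _ => zero_le_one) _,
      Set.indicator_le_self' (fun _ _ => zero_le_one) _⟩
  have hlim : Tendsto (fun n : ℕ => (1 / (n : ℝ)) * ∑ i ∈ Finset.range n, g (i + 1) -
      (1 / (n : ℝ)) * ∑ i ∈ Finset.range n, g i) atTop (nhds 0) := by
    refine squeeze_zero_norm (fun n => ?_) tendsto_one_div_atTop_nhds_zero_nat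
    rw [← mul_sub, ← Finset.sum_sub_distrib, Finset.sum_range_sub, norm_mul,
      Real.norm_of_nonneg (by positivity)]
    refine mul_le_of_le_one_right (by positivity) (abs_le.2 ⟨?_, ?_⟩)
    · linarith [(hg01 n).1, (hg01 0).2]
    · linarith [(hg01 n).2, (hg01 0).1]
  have h1 := frequency_mem_Icc B (fun i => u (i + 1))
  have h2 := frequency_mem_Icc B u
  refine le_antisymm (limsup_le_limsup_of_tendsto_sub h2 hlim)
    (limsup_le_limsup_of_tendsto_sub h1 ?_)
  simpa using hlim.neg

/-- An upper frequency above `c` forces some finite average above `c`, so the maximal inequality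
applies to the event `u 0 ∈ B`, whose stationary probability is `μ B`. -/
theorem mul_measure_upperFrequency_gt_le {E : Type*} [MeasurableSpace E] (P : Kernel E E)
    [IsMarkovKernel P] {μ : Measure E} [IsFiniteMeasure μ] (hμ : P.Invariant μ) {B : Set E}
    (hB : MeasurableSet B) {c : ℝ} (hc : 0 < c) :
    ENNReal.ofReal c * (μ.bind (chainKernel P)) {u | c < upperFrequency B u} ≤ μ B := by
  have hev : Measurable fun u : ℕ → E => u 0 := measurable_pi_apply 0
  have hzero : (μ.bind (chainKernel P)).map (fun u => u 0) = μ := by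
    rw [Measure.map_comp _ _ hev]
    have : (chainKernel P).map (fun u => u 0) = Kernel.id := by
      ext1 x
      rw [Kernel.map_apply _ hev, chainKernel_apply, chainLaw_map_zero, Kernel.id_apply]
    rw [this, Measure.id_comp]
  have hT := measurePreserving_shift P hμ
  have h := measure_birkhoffSum_indicator_gt_le hT (hev hB) hc
  rw [← Measure.map_apply hev hB, hzero] at h
  refine le_trans ?_ h
  refine mul_le_mul_right (measure_mono fun u hu => ?_) _
  obtain ⟨n, hn⟩ := (frequently_lt_of_lt_limsup
    (isBoundedUnder_of_mem_Icc (frequency_mem_Icc B u)).2.isCoboundedUnder_le hu).exists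
  refine ⟨n, ?_⟩
  have hn0 : (0 : ℝ) < n := by
    rcases Nat.eq_zero_or_pos n with rfl | h
    · simp at hn
      exact absurd hn (not_lt.2 hc.le)
    · exact_mod_cast h
  have hit : ∀ k, (fun (u : ℕ → E) i => u (i + 1))^[k] u 0 = u k := by
    intro k
    have : ∀ k i, (fun (u : ℕ → E) i => u (i + 1))^[k] u i = u (i + k) := by
      intro k
      induction k with
      | zero => simp
      | succ k ih =>
        intro i
        rw [Function.iterate_succ_apply', ih]
        congr 1
        omega
    simpa using this k 0
  have hs : birkhoffSum (fun (u : ℕ → E) i => u (i + 1))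
      (((fun u : ℕ → E => u 0) ⁻¹' B).indicator fun _ => (1 : ℝ)) n u =
      ∑ i ∈ Finset.range n, B.indicator (fun _ => (1 : ℝ)) (u i) := by
    refine Finset.sum_congr rfl fun i _ => ?_
    change B.indicator (fun _ => (1 : ℝ)) ((fun (u : ℕ → E) i => u (i + 1))^[i] u 0) = _
    rw [hit]
  rw [hs]
  rw [one_div_mul_eq_div, lt_div_iff₀ hn0] at hn
  linarith

/-- If the masses of the sets `B k` under an invariant measure decay fast, then for almost every
starting point the chain eventually visits `B k` with small frequency. -/
theorem ae_eventually_ae_upperFrequency_le {E : Type*} [MeasurableSpace E] (P : Kernel E E)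
    [IsMarkovKernel P] {μ : Measure E} [IsFiniteMeasure μ] (hμ : P.Invariant μ) {B : ℕ → Set E}
    (hB : ∀ k, MeasurableSet (B k)) (hμB : ∀ k, μ (B k) ≤ ENNReal.ofReal ((1 / 4) ^ k)) :
    ∀ᵐ x ∂μ, ∀ᶠ k in atTop, ∀ᵐ u ∂chainLaw P x, upperFrequency (B k) u ≤ (1 / 2) ^ k := by
  -- Since `4⁻ᵏ = 2⁻ᵏ · 2⁻ᵏ`, the threshold `2⁻ᵏ` leaves a summable bound `2⁻ᵏ`.
  have h1 : ∀ k, (μ.bind (chainKernel P)) {u | (1 / 2) ^ k < upperFrequency (B k) u} ≤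
      ENNReal.ofReal ((1 / 2) ^ k) := by
    intro k
    have h := (mul_measure_upperFrequency_gt_le P hμ (hB k)
      (c := (1 / 2) ^ k) (by positivity)).trans (hμB k)
    have e : ((1 / 4 : ℝ)) ^ k = (1 / 2) ^ k * (1 / 2) ^ k := by
      rw [← mul_pow]; norm_num
    rw [e, ENNReal.ofReal_mul (by positivity)] at h
    exact (ENNReal.mul_le_mul_iff_right (by positivity) ENNReal.ofReal_ne_top).1 h
  have h2 : ∀ᵐ u ∂μ.bind (chainKernel P), ∀ᶠ k in atTop, upperFrequency (B k) u ≤ (1 / 2) ^ k := by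
    have hs : ∑' k, (μ.bind (chainKernel P)) {u | (1 / 2) ^ k < upperFrequency (B k) u} ≠ ⊤ := by
      refine ne_top_of_le_ne_top ?_ (ENNReal.tsum_le_tsum h1)
      rw [← ENNReal.ofReal_tsum_of_nonneg (fun k => by positivity) summable_geometric_two]
      exact ENNReal.ofReal_ne_top
    filter_upwards [ae_eventually_notMem hs] with u hu
    filter_upwards [hu] with k hk
    simpa using hk
  have h3 : ∀ᵐ x ∂μ, ∀ k, ∀ᵐ u ∂chainLaw P x,
      upperFrequency (B k) u = ∫ v, upperFrequency (B k) v ∂chainLaw P x := by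
    refine ae_all_iff.2 fun k => ae_ae_eq_integral_chainLaw P hμ
      (measurable_upperFrequency (hB k)) (C := 1) (fun u => ?_) (upperFrequency_shift (B k))
    have := upperFrequency_mem_Icc (B k) u
    rw [abs_of_nonneg this.1]
    exact this.2
  filter_upwards [Measure.ae_ae_of_ae_comp h2, h3] with x hx1 hx2
  rw [chainKernel_apply] at hx1
  -- The index in Borel–Cantelli depends on the path. As every frequency is almost surely constant,
  -- a single typical path `u` supplies an index valid for almost all paths.
  obtain ⟨u, hu1, hu2⟩ := (hx1.and (ae_all_iff.2 hx2)).exists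
  filter_upwards [hu1] with k hk
  filter_upwards [hx2 k] with v hv
  rw [hv, ← hu2 k]
  exact hk

/-! ### Mutually singular invariant measures and their separation. -/

/-- Subtraction of measures is truncated, so `μ - ν` is a Jordan part. From `μ ≤ (μ - ν) + ν`,
applying `P` gives `μ - ν ≤ (μ - ν)P`; total masses agree, so equality holds. -/
theorem invariant_sub {E : Type*} [MeasurableSpace E] {P : Kernel E E} [IsMarkovKernel P]
    {μ ν : Measure E} [IsFiniteMeasure μ] [IsFiniteMeasure ν] (hμ : P.Invariant μ)
    (hν : P.Invariant ν) : P.Invariant (μ - ν) := by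
  have h1 : μ - ν ≤ (μ - ν).bind P := by
    refine Measure.sub_le_of_le_add ?_
    calc μ = μ.bind P := hμ.def.symm
      _ ≤ ((μ - ν) + ν).bind P := by
        refine Measure.le_iff.2 fun s hs => ?_
        rw [Measure.bind_apply hs P.measurable.aemeasurable,
          Measure.bind_apply hs P.measurable.aemeasurable]
        exact lintegral_mono' (Measure.sub_le_iff_le_add.1 le_rfl) le_rfl
      _ = (μ - ν).bind P + ν := by rw [Measure.comp_add, hν.def]
  have h2 : (μ - ν).bind P Set.univ ≤ (μ - ν) Set.univ := by
    rw [Measure.bind_apply .univ P.measurable.aemeasurable]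
    simp
  exact (Measure.eq_of_le_of_measure_univ_eq h1 (le_antisymm (h1 _) h2)).symm

theorem exists_mutuallySingular_invariant {E : Type*} [MeasurableSpace E] {P : Kernel E E}
    [IsMarkovKernel P] {μ ν : Measure E} [IsProbabilityMeasure μ] [IsProbabilityMeasure ν]
    (hμ : P.Invariant μ) (hν : P.Invariant ν) (hne : μ ≠ ν) :
    ∃ μ' ν' : Measure E, IsProbabilityMeasure μ' ∧ IsProbabilityMeasure ν' ∧ P.Invariant μ' ∧
      P.Invariant ν' ∧ μ'.MutuallySingular ν' := by
  have hsub : ∀ {μ ν : Measure E} [IsProbabilityMeasure μ] [IsProbabilityMeasure ν],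
      μ ≠ ν → μ - ν ≠ 0 := by
    intro μ ν _ _ hne h0
    have h := Measure.sub_le_iff_le_add.1 h0.le
    rw [zero_add] at h
    exact hne (Measure.eq_of_le_of_isProbabilityMeasure h)
  have hsmul : ∀ {m : Measure E} (c : ENNReal), P.Invariant m → P.Invariant (c • m) := by
    intro m c hm
    rw [Kernel.Invariant, Measure.comp_smul, hm.def]
  have h1 : NeZero (μ - ν) := ⟨hsub hne⟩
  have h2 : NeZero (ν - μ) := ⟨hsub hne.symm⟩
  refine ⟨((μ - ν) Set.univ)⁻¹ • (μ - ν), ((ν - μ) Set.univ)⁻¹ • (ν - μ),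
    isProbabilityMeasureSMul, isProbabilityMeasureSMul, hsmul _ (invariant_sub hμ hν),
    hsmul _ (invariant_sub hν hμ), ?_⟩
  exact (Measure.mutually_singular_measure_sub.smul _).symm.smul _ |>.symm

/-- Mutually singular finite measures live, up to a small mass, on sets that are uniformly separated
for the metric. -/
theorem exists_dist_separated {E : Type*} [MetricSpace E] [MeasurableSpace E] [BorelSpace E]
    {μ ν : Measure E} [IsFiniteMeasure μ] [IsFiniteMeasure ν] (h : μ.MutuallySingular ν)
    {δ : ENNReal} (hδ : δ ≠ 0) :
    ∃ F G : Set E, MeasurableSet F ∧ MeasurableSet G ∧ μ Fᶜ ≤ δ ∧ ν Gᶜ ≤ δ ∧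
      ∃ ε : ℝ, 0 < ε ∧ ∀ x ∈ F, ∀ y ∈ G, ε < dist x y := by
  obtain ⟨s, hs, hμs, hνs⟩ := h
  have hδ2 : δ / 2 ≠ 0 := by simpa using hδ
  obtain ⟨F, hFs, hF, hμF⟩ := hs.compl.exists_isClosed_sdiff_lt (measure_ne_top μ _) hδ2
  obtain ⟨G, hGs, hG, hνG⟩ := hs.exists_isClosed_sdiff_lt (measure_ne_top ν _) hδ
  have hdisj : ∀ x ∈ F, 0 < Metric.infEDist x G := fun x hx =>
    Metric.infEDist_pos_iff_notMem_closure.2 (by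
      rw [hG.closure_eq]
      exact fun hxG => hFs hx (hGs hxG))
  -- Disjoint closed sets may be at distance zero. The layers of `F` within `1 / (n + 1)` of `G`
  -- decrease to the empty set, so removing one costs at most the other `δ / 2`.
  set A : ℕ → Set E := fun n => F ∩ {x | Metric.infEDist x G ≤ ((n : ENNReal) + 1)⁻¹} with hA
  have hAm : ∀ n, MeasurableSet (A n) := fun n =>
    hF.measurableSet.inter (measurableSet_le measurable_infEDist measurable_const)
  have hanti : Antitone A := fun i j hij x hx => ⟨hx.1, hx.2.trans
    (ENNReal.inv_le_inv.2 (add_le_add (Nat.cast_le.2 hij) le_rfl))⟩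
  have hempty : ⋂ n, A n = ∅ := by
    refine Set.eq_empty_of_forall_notMem fun x hx => ?_
    rw [Set.mem_iInter] at hx
    obtain ⟨n, hn⟩ := ENNReal.exists_inv_nat_lt (hdisj x (hx 0).1).ne'
    refine absurd (hx n).2 (not_le.2 (lt_of_le_of_lt ?_ hn))
    gcongr
    exact le_self_add
  have hlim := tendsto_measure_iInter_atTop (μ := μ) (fun n => (hAm n).nullMeasurableSet) hanti
    ⟨0, measure_ne_top μ _⟩
  rw [hempty, measure_empty] at hlim
  obtain ⟨n, hn⟩ := (hlim.eventually_lt_const (pos_iff_ne_zero.2 hδ2)).exists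
  refine ⟨F \ A n, G, hF.measurableSet.diff (hAm n), hG.measurableSet, ?_, ?_, 1 / (n + 1 : ℝ),
    by positivity, fun x hx y hy => ?_⟩
  · have : (F \ A n)ᶜ ⊆ s ∪ (sᶜ \ F) ∪ A n := by
      intro x hx
      by_cases h1 : x ∈ s
      · exact .inl (.inl h1)
      by_cases h2 : x ∈ F
      · exact .inr (by_contra fun h3 => hx ⟨h2, h3⟩)
      · exact .inl (.inr ⟨h1, h2⟩)
    calc μ (F \ A n)ᶜ ≤ μ s + μ (sᶜ \ F) + μ (A n) :=
          (measure_mono this).trans ((measure_union_le _ _).trans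
            (add_le_add (measure_union_le _ _) le_rfl))
      _ ≤ 0 + δ / 2 + δ / 2 := add_le_add (add_le_add hμs.le hμF.le) hn.le
      _ = δ := by rw [zero_add, ENNReal.add_halves]
  · have : Gᶜ ⊆ sᶜ ∪ (s \ G) := by
      intro x hx
      by_cases h1 : x ∈ s
      · exact .inr ⟨h1, hx⟩
      · exact .inl h1
    calc ν Gᶜ ≤ ν sᶜ + ν (s \ G) := (measure_mono this).trans (measure_union_le _ _)
      _ ≤ 0 + δ := add_le_add hνs.le hνG.le
      _ = δ := zero_add _
  · have h1 : ((n : ENNReal) + 1)⁻¹ < Metric.infEDist x G := not_le.1 fun h => hx.2 ⟨hx.1, h⟩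
    have h2 := h1.trans_le (Metric.infEDist_le_edist_of_mem hy)
    have h3 : ((n : ENNReal) + 1)⁻¹ = ENNReal.ofReal (1 / (n + 1 : ℝ)) := by
      rw [one_div, ENNReal.ofReal_inv_of_pos (by positivity),
        ENNReal.ofReal_add (by positivity) zero_le_one]
      simp
    rw [h3, edist_dist] at h2
    exact (ENNReal.ofReal_lt_ofReal_iff_of_nonneg (by positivity)).1 h2

/-- Mutually singular finite measures on a Polish space live, up to a small mass, on sets that are
uniformly separated for a positive definite lower semicontinuous function. -/
theorem exists_lowerSemicontinuous_separated {E : Type*} [TopologicalSpace E] [PolishSpace E]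
    [MeasurableSpace E] [BorelSpace E] {ρ : E → E → ℝ} (h0 : ∀ x y, 0 ≤ ρ x y)
    (hpos : ∀ x y, ρ x y = 0 ↔ x = y)
    (hρ : LowerSemicontinuous fun p : E × E => ρ p.1 p.2)
    {μ ν : Measure E} [IsFiniteMeasure μ] [IsFiniteMeasure ν] (h : μ.MutuallySingular ν)
    {δ : ENNReal} (hδ : δ ≠ 0) :
    ∃ F G : Set E, MeasurableSet F ∧ MeasurableSet G ∧ μ Fᶜ ≤ δ ∧ ν Gᶜ ≤ δ ∧
      ∃ ε : ℝ, 0 < ε ∧ ∀ x ∈ F, ∀ y ∈ G, ε < ρ x y := by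
  obtain ⟨s, hs, hμs, hνs⟩ := h
  obtain ⟨F, hFs, hF, hμF⟩ := hs.compl.exists_isCompact_sdiff_lt (measure_ne_top μ _) hδ
  obtain ⟨G, hGs, hG, hνG⟩ := hs.exists_isCompact_sdiff_lt (measure_ne_top ν _) hδ
  refine ⟨F, G, hF.measurableSet, hG.measurableSet, ?_, ?_, ?_⟩
  · have : Fᶜ ⊆ s ∪ (sᶜ \ F) := by
      intro x hx
      by_cases h1 : x ∈ s
      · exact .inl h1
      · exact .inr ⟨h1, hx⟩
    calc μ Fᶜ ≤ μ s + μ (sᶜ \ F) := (measure_mono this).trans (measure_union_le _ _)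
      _ ≤ 0 + δ := add_le_add hμs.le hμF.le
      _ = δ := zero_add _
  · have : Gᶜ ⊆ sᶜ ∪ (s \ G) := by
      intro x hx
      by_cases h1 : x ∈ s
      · exact .inr ⟨h1, hx⟩
      · exact .inl h1
    calc ν Gᶜ ≤ ν sᶜ + ν (s \ G) := (measure_mono this).trans (measure_union_le _ _)
      _ ≤ 0 + δ := add_le_add hνs.le hνG.le
      _ = δ := zero_add _
  · rcases (F ×ˢ G).eq_empty_or_nonempty with he | hne
    · refine ⟨1, one_pos, fun x hx y hy => ?_⟩
      have : (x, y) ∈ F ×ˢ G := ⟨hx, hy⟩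
      simp [he] at this
    -- A lower semicontinuous function attains its minimum on a compact set; it is positive because
    -- `F` and `G` are disjoint, and halving it makes the bound strict.
    · obtain ⟨⟨a, b⟩, ⟨ha, hb⟩, hmin⟩ :=
        (hρ.lowerSemicontinuousOn _).exists_isMinOn hne (hF.prod hG)
      have hab : 0 < ρ a b := (h0 a b).lt_of_ne fun e =>
        hFs ha (hGs (((hpos a b).1 e.symm) ▸ hb))
      refine ⟨ρ a b / 2, half_pos hab, fun x hx y hy => ?_⟩
      have : ρ a b ≤ ρ x y := hmin (show (x, y) ∈ F ×ˢ G from ⟨hx, hy⟩)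
      linarith

/-! ### Closeness of coupled paths and conclusion. -/

/-- Whenever `ρ (u i) (v i) ≤ ε`, either `u i ∉ F` or `v i ∉ G`. -/
theorem limsup_closenessFrequency_le {E : Type*} {ρ : E → E → ℝ} {F G : Set E} {ε : ℝ}
    (h : ∀ x ∈ F, ∀ y ∈ G, ε < ρ x y) (u v : ℕ → E) :
    limsup (fun n => closenessFrequency ρ ε u v n) atTop ≤
      upperFrequency Fᶜ u + upperFrequency Gᶜ v := by
  have hu := isBoundedUnder_of_mem_Icc (frequency_mem_Icc Fᶜ u)
  have hv := isBoundedUnder_of_mem_Icc (frequency_mem_Icc Gᶜ v)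
  refine le_trans ?_ (limsup_add_le hu.2 hu.1 hv.2.isCoboundedUnder_le hv.1)
  refine limsup_le_limsup (Eventually.of_forall fun n => ?_) ?_ (isBoundedUnder_le_add hu.1 hv.1)
  · simp only [closenessFrequency, Pi.add_apply]
    rw [← mul_add, ← Finset.sum_add_distrib]
    refine mul_le_mul_of_nonneg_left (Finset.sum_le_sum fun i _ => ?_) (by positivity)
    by_cases h1 : u i ∈ F
    · by_cases h2 : v i ∈ G
      · have : ρ (u i) (v i) ∉ Set.Icc 0 ε := fun hm => absurd (h _ h1 _ h2) (not_lt.2 hm.2)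
        simp [Set.indicator, this, h1, h2]
      · rw [Set.indicator_of_mem (s := Gᶜ) h2]
        refine (Set.indicator_le_self' (fun _ _ => zero_le_one) _).trans
          (le_add_of_nonneg_left (Set.indicator_nonneg (fun _ _ => zero_le_one) _))
    · rw [Set.indicator_of_mem (s := Fᶜ) h1]
      refine (Set.indicator_le_self' (fun _ _ => zero_le_one) _).trans
        (le_add_of_nonneg_right (Set.indicator_nonneg (fun _ _ => zero_le_one) _))
  · refine IsBoundedUnder.isCoboundedUnder_le (isBoundedUnder_of ⟨0, fun n => ?_⟩)
    exact mul_nonneg (by positivity) (Finset.sum_nonneg fun i _ =>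
      Set.indicator_nonneg (fun _ _ => zero_le_one) _)

theorem mainTheorem2 {E : Type*} [MetricSpace E] [MeasurableSpace E] [BorelSpace E]
    (P : Kernel E E) [IsMarkovKernel P]
    (ρ : E → E → ℝ)
    (hρ : ρ = dist ∨
      (PolishSpace E ∧ (∀ x y, 0 ≤ ρ x y) ∧ (∀ x y, ρ x y = 0 ↔ x = y) ∧
        LowerSemicontinuous (fun p : E × E => ρ p.1 p.2)))
    (M : Set E) (hM : MeasurableSet M)
    (hcharge : ∀ μ : Measure E, IsProbabilityMeasure μ → P.Invariant μ → 0 < μ M)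
    (hcoupling : ∀ x ∈ M, ∀ y ∈ M, ∃ α : ℝ, 0 < α ∧ ∀ ε : ℝ, 0 < ε →
      ∃ ξ ∈ generalizedCouplings (chainLaw P x) (chainLaw P y),
        -- for a non-measurable event, `ξ` is the outer measure
        0 < ξ {z : (ℕ → E) × (ℕ → E) |
          α ≤ limsup (fun n : ℕ => closenessFrequency ρ ε z.1 z.2 n) atTop}) :
    ∀ μ ν : Measure E, IsProbabilityMeasure μ → IsProbabilityMeasure ν →
      P.Invariant μ → P.Invariant ν → μ = ν := by
  intro μ₀ ν₀ _ _ hμ₀ hν₀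
  by_contra hne
  obtain ⟨μ, ν, hμp, hνp, hμ, hν, hsing⟩ := exists_mutuallySingular_invariant hμ₀ hν₀ hne
  have hsep : ∀ δ : ENNReal, δ ≠ 0 →
      ∃ F G : Set E, MeasurableSet F ∧ MeasurableSet G ∧ μ Fᶜ ≤ δ ∧ ν Gᶜ ≤ δ ∧
        ∃ ε : ℝ, 0 < ε ∧ ∀ x ∈ F, ∀ y ∈ G, ε < ρ x y := by
    intro δ hδ
    rcases hρ with rfl | ⟨hE, h0, hpos, hlsc⟩
    · exact exists_dist_separated hsing hδ
    · exact exists_lowerSemicontinuous_separated h0 hpos hlsc hsing hδ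
  have hδ : ∀ k : ℕ, ENNReal.ofReal ((1 / 4) ^ k) ≠ 0 := fun k => by
    rw [Ne, ENNReal.ofReal_eq_zero, not_le]
    positivity
  choose F G hF hG hμF hνG ε hε hFG using fun k : ℕ => hsep _ (hδ k)
  have exists_good : ∀ {m : Measure E} {p : E → Prop}, 0 < m M → (∀ᵐ x ∂m, p x) →
      ∃ x ∈ M, p x := by
    intro m p hm hp
    exact ((frequently_ae_mem_iff.2 hm.ne').and_eventually hp).exists
  obtain ⟨x, hxM, hx⟩ := exists_good (hcharge μ hμp hμ)
    (ae_eventually_ae_upperFrequency_le P hμ (fun k => (hF k).compl) hμF)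
  obtain ⟨y, hyM, hy⟩ := exists_good (hcharge ν hνp hν)
    (ae_eventually_ae_upperFrequency_le P hν (fun k => (hG k).compl) hνG)
  -- `α` depends on `x, y` only, so `k`, and with it `ε k`, can be chosen after it.
  obtain ⟨α, hα, hξ⟩ := hcoupling x hxM y hyM
  have hsmall : ∀ᶠ k : ℕ in atTop, ((1 : ℝ) / 2) ^ k < α / 2 :=
    (tendsto_pow_atTop_nhds_zero_of_lt_one (by norm_num) (by norm_num)).eventually_lt_const
      (half_pos hα)
  obtain ⟨k, hxk, hyk, hk⟩ := (hx.and (hy.and hsmall)).exists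
  obtain ⟨ξ, ⟨-, hξ1, hξ2⟩, hpos⟩ := hξ (ε k) (hε k)
  -- Absolute continuity of the marginals transfers null sets only, which suffices for almost sure
  -- bounds.
  have h1 : ∀ᵐ z ∂ξ, upperFrequency (F k)ᶜ z.1 ≤ (1 / 2) ^ k :=
    ae_of_ae_map measurable_fst.aemeasurable (hξ1.ae_le hxk)
  have h2 : ∀ᵐ z ∂ξ, upperFrequency (G k)ᶜ z.2 ≤ (1 / 2) ^ k :=
    ae_of_ae_map measurable_snd.aemeasurable (hξ2.ae_le hyk)
  -- The event lies in a null set, so its outer measure vanishes whether or not it is measurable.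
  refine hpos.ne' (measure_mono_null (fun z hz => ?_) (ae_iff.1 (h1.and h2)))
  rintro ⟨hz1, hz2⟩
  have hz' : α ≤ limsup (fun n => closenessFrequency ρ (ε k) z.1 z.2 n) atTop := hz
  have := limsup_closenessFrequency_le (hFG k) z.1 z.2
  linarith
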